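/- Let $(X_n)_{n\ge 1}$ be a sequence of real random variables on a measurable space $(\Omega,\mathcal F)$, and let $\theta\in\mathbb R$, $\delta>0$, $\gamma\in(0,1/2)$. Let $\mathcal M_{2+\delta}(\theta)$ be the set of distributions on $\mathbb R$ with mean $\theta$ and finite $(2+\delta)$-th moment, and let $\mathcal P_{2+\delta}(\theta)$ be the set of all probability measures $P$ on $(\Omega,\mathcal F)$ under which the $X_n$ are iid with common distribution in $\mathcal M_{2+\delta}(\theta)$. Write $$S_n(\theta)=\sum_{i\le n}(X_i-\theta),\qquad \overline X_n=\frac1n\sum_{i\le n}X_i,\qquad \hat s_n^2=\frac1n\sum_{i\le n}(X_i-\overline X_n)^2 .$$ Let $(T_n)$ and $(\epsilon_n)$ be sequences of nonnegative numbers with $T_n\to\infty$, $\epsilon_n\to0$ and $T_n=o\big(n^{\delta\gamma/2}\,\epsilon_n^{2+\delta/2}\big)$ as $n\to\infty$, let $F$ be any probability distribution on $\mathbb R$ (possibly a point mass), and put $$E_n=\Big(\int_{\mathbb R}\exp\Big(\lambda S_n(\theta)-n(\hat s_n^2+\epsilon_n)\frac{\lambda^2}{2}\Big)\,dF(\lambda)\Big)\wedge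 T_n .$$ Then $(E_n)$ is an asymptotic e-variable for $\mathcal P_{2+\delta}(\theta)$, that is, the $E_n$ are nonnegative random variables with $$\sup_{P\in\mathcal P_{2+\delta}(\theta)}\ \limsup_{n\to\infty}\ \mathbb E_P[E_n]\le 1 .$$ Moreover, for every subset $\mathcal P\subseteq\mathcal P_{2+\delta}(\theta)$ with $\sup_{P\in\mathcal P}\mathbb E_P|X_n|^{2+\delta}<\infty$ for every $n$ (by identical distribution the value of the supremum does not depend on $n$), $(E_n)$ is a $\mathcal P$-uniform asymptotic e-variable, that is, $$\limsup_{n\to\infty}\ \sup_{P\in\mathcal P}\ \mathbb E_P[E_n]\le 1 .$$ -/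

import Mathlib

open MeasureTheory ProbabilityTheory Filter Asymptotics
open scoped ENNReal Topology

noncomputable section

/-- The probability distributions on `ℝ` with mean `θ` and finite `q`-th (absolute, centred)
moment. -/
def momentClass (q θ : ℝ) : Set (Measure ℝ) :=
  {μ | IsProbabilityMeasure μ ∧ Integrable (fun x : ℝ => x) μ ∧ ∫ x, x ∂μ = θ ∧
    Integrable (fun x : ℝ => |x - θ| ^ q) μ}

section Model

variable {Ω : Type*} [MeasurableSpace Ω]

/-- The probability measures on the sample space under which the sequence `X 0, X 1, …` is iid
with a common distribution in `momentClass q θ`. -/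
def iidLaws (X : ℕ → Ω → ℝ) (q θ : ℝ) : Set (Measure Ω) :=
  {P | IsProbabilityMeasure P ∧ iIndepFun X P ∧ (∀ n, IdentDistrib (X n) (X 0) P P) ∧
    P.map (X 0) ∈ momentClass q θ}

/-- `Y` has a `𝒬`-uniformly bounded `q`-th moment: `sup_{P ∈ 𝒬} E_P |Y|^q < ∞`. -/
def HasUniformlyBoundedMoment (𝒬 : Set (Measure Ω)) (Y : Ω → ℝ) (q : ℝ) : Prop :=
  (⨆ P ∈ 𝒬, ∫⁻ ω, ENNReal.ofReal (|Y ω| ^ q) ∂P) < ∞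

/-- A sequence of nonnegative random variables with `sup_{P ∈ 𝒬} limsup_n E_P[E_n] ≤ 1`. -/
def IsAsymptoticEVariable (𝒬 : Set (Measure Ω)) (E : ℕ → Ω → ℝ≥0∞) : Prop :=
  (∀ n, Measurable (E n)) ∧
    (⨆ P ∈ 𝒬, limsup (fun n => ∫⁻ ω, E n ω ∂P) atTop) ≤ 1

/-- A sequence of nonnegative random variables with `limsup_n sup_{P ∈ 𝒬} E_P[E_n] ≤ 1`. -/
def IsUniformAsymptoticEVariable (𝒬 : Set (Measure Ω)) (E : ℕ → Ω → ℝ≥0∞) : Prop :=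
  (∀ n, Measurable (E n)) ∧
    limsup (fun n => ⨆ P ∈ 𝒬, ∫⁻ ω, E n ω ∂P) atTop ≤ 1

/-- The centred sum `S_n(θ)` of the first `n` observations `X 0, …, X (n - 1)`. -/
def centredSum (X : ℕ → Ω → ℝ) (θ : ℝ) (n : ℕ) (ω : Ω) : ℝ :=
  ∑ i ∈ Finset.range n, (X i ω - θ)

/-- The sample mean of the first `n` observations. -/
def sampleMean (X : ℕ → Ω → ℝ) (n : ℕ) (ω : Ω) : ℝ :=
  (∑ i ∈ Finset.range n, X i ω) / n

/-- The biased sample variance `ŝ_n²` of the first `n` observations. -/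
def sampleVar (X : ℕ → Ω → ℝ) (n : ℕ) (ω : Ω) : ℝ :=
  (∑ i ∈ Finset.range n, (X i ω - sampleMean X n ω) ^ 2) / n

/-- The truncated mixture
`(∫ exp (l * S_n(θ) - n (ŝ_n² + ε_n) l² / 2) dF(l)) ∧ T_n`, with values in `[0, ∞]`. -/
def rwsEVariable (X : ℕ → Ω → ℝ) (θ : ℝ) (F : Measure ℝ) (ε T : ℕ → ℝ) (n : ℕ) (ω : Ω) :
    ℝ≥0∞ :=
  min
    (∫⁻ l, ENNReal.ofReal
      (Real.exp (l * centredSum X θ n ω - n * (sampleVar X n ω + ε n) * (l ^ 2 / 2))) ∂F)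
    (ENNReal.ofReal (T n))

end Model

end

/-!
Write `Y i = X i - θ`, `S` and `Q` for the sums of the first `n` of the `Y i` and of their squares,
and `V` for the variance. The inequality `exp (y - y² / 6) ≤ 1 + y + y² / 3`
(`exp_sub_sq_div_six_le`) makes `exp (l S - (l² / 2) (Q / 3 + 2 n V / 3))` a variable of mean at most
one for every `l`, so its mixture over `F` has mean at most one
(`IsCentredIID.lintegral_mixture_le_one`). Since `n ŝ² = Q - S² / n`, the given mixture is at most
this one as soon as `n (ŝ² + ε) ≥ Q / 3 + 2 n V / 3`, which holds if `Q > n (V - 3 ε / 4)` and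
`S² ≤ n² ε / 2`. Elsewhere the truncation at `T` is used, so that the mean is at most `1` plus
`T` times the probability of the exceptional event (`lintegral_rwsEVariable_le`).

Chebyshev's inequality for `S` is too weak when `δ` is large. Exponential bounds, which also avoid
moment inequalities of Rosenthal type, are available once the exceptional event is split in three.

* `Q > n ^ (1 + γ)`: Jensen's and Markov's inequalities give `O(n ^ (-γ (1 + δ / 2)))`.
* `Q ≤ n ^ (1 + γ)` and `S² > n² ε / 2`: the self-normalised exponential gives a Gaussian bound with
  exponent of order `n ^ (1 - γ) ε`.
* `Q ≤ n (V - 3 ε / 4)`: the lower tail of a sum of nonnegative variables is exponentially small, by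
  `exp (-x) ≤ 1 - x + x ^ p` with `p = min (1 + δ / 2) 2`.

As `T → ∞`, the growth condition forces `ε ≥ n ^ (-δ γ / (4 + δ))` and `T ≤ n ^ (δ γ / 2)`
eventually, and with `γ < 1 / 2` the three probabilities multiplied by `T` tend to zero
(`tendsto_mul_deviationBound`). The bounds depend on the law only through a bound for its moment of
order `2 + δ`, so both claims follow from one uniform estimate, the first one for a single law.
-/

/-! ### Elementary inequalities -/

/-- The function `(1 + y + y² / 3) * exp (-y + y² / 6)` has derivative `y³ / 9 * exp (-y + y² / 6)`,
so it is minimal at `0`. -/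
theorem exp_sub_sq_div_six_le (y : ℝ) : Real.exp (y - y ^ 2 / 6) ≤ 1 + y + y ^ 2 / 3 := by
  set g : ℝ → ℝ := fun y => (1 + y + y ^ 2 / 3) * Real.exp (-y + y ^ 2 / 6) with hg
  have hd : ∀ x, HasDerivAt g (x ^ 3 / 9 * Real.exp (-x + x ^ 2 / 6)) x := by
    intro x
    have h1 : HasDerivAt (fun y : ℝ => 1 + y + y ^ 2 / 3) (1 + 2 * x / 3) x := by
      have := ((hasDerivAt_id x).const_add 1).add (((hasDerivAt_id x).pow 2).div_const 3)
      convert! this using 1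
      simp
    have h2 : HasDerivAt (fun y : ℝ => -y + y ^ 2 / 6) (-1 + 2 * x / 6) x := by
      have := (hasDerivAt_id x).neg.add (((hasDerivAt_id x).pow 2).div_const 6)
      convert! this using 1
      simp
    convert! h1.mul h2.exp using 1
    ring
  have hc : Continuous g := by fun_prop
  have hmin : 1 ≤ g y := by
    have h0 : g 0 = 1 := by simp [hg]
    rw [← h0]
    rcases le_total 0 y with hy | hy
    · refine monotoneOn_of_deriv_nonneg (convex_Ici 0) hc.continuousOn
        (fun x _ => (hd x).differentiableAt.differentiableWithinAt) (fun x hx => ?_)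
        (Set.self_mem_Ici) hy hy
      rw [interior_Ici, Set.mem_Ioi] at hx
      rw [(hd x).deriv]
      positivity
    · refine antitoneOn_of_deriv_nonpos (convex_Iic 0) hc.continuousOn
        (fun x _ => (hd x).differentiableAt.differentiableWithinAt) (fun x hx => ?_)
        hy (Set.self_mem_Iic) hy
      rw [interior_Iic, Set.mem_Iio] at hx
      rw [(hd x).deriv]
      have : x ^ 3 ≤ 0 := (Odd.pow_nonpos_iff (by decide)).2 hx.le
      exact mul_nonpos_of_nonpos_of_nonneg (by linarith) (Real.exp_pos _).le
  have hmul : Real.exp (y - y ^ 2 / 6) * Real.exp (-y + y ^ 2 / 6) = 1 := by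
    rw [← Real.exp_add]
    simp
  refine le_of_mul_le_mul_right ?_ (Real.exp_pos (-y + y ^ 2 / 6))
  rw [hmul]
  exact hmin

theorem exp_neg_le_one_sub_add_rpow {x p : ℝ} (hx : 0 ≤ x) (hp : 1 ≤ p) (hp' : p ≤ 2) :
    Real.exp (-x) ≤ 1 - x + x ^ p := by
  rcases le_total x 1 with h | h
  · have h1 := (abs_le.1 (Real.abs_exp_sub_one_sub_id_le (x := -x)
      (by rw [abs_neg, abs_of_nonneg hx]; exact h))).2
    have h2 : x ^ 2 ≤ x ^ p := by
      rw [← Real.rpow_two]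
      exact Real.rpow_le_rpow_of_exponent_ge_of_imp hx h hp' (by intro _ h0; linarith)
    nlinarith
  · have h1 : Real.exp (-x) ≤ 1 := Real.exp_le_one_iff.2 (by linarith)
    have h2 : x ≤ x ^ p := Real.self_le_rpow_of_one_le h hp
    linarith

theorem rpow_le_one_add_rpow {x a q : ℝ} (hx : 0 ≤ x) (ha : 0 ≤ a) (haq : a ≤ q) :
    x ^ a ≤ 1 + x ^ q := by
  rcases le_total x 1 with h | h
  · linarith [Real.rpow_le_one hx h ha, Real.rpow_nonneg hx q]
  · linarith [Real.rpow_le_rpow_of_exponent_le h haq]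

/-! ### Centred iid sequences with a moment bound -/

section IID

variable {Ω : Type*} [MeasurableSpace Ω]

/-- `Y` is an iid sequence of centred random variables under `P` whose absolute moment of order `q`
is finite and at most `M`. -/
structure IsCentredIID (Y : ℕ → Ω → ℝ) (P : Measure Ω) (q M : ℝ) : Prop where
  prob : IsProbabilityMeasure P
  meas : ∀ i, Measurable (Y i)
  indep : iIndepFun Y P
  ident : ∀ i, IdentDistrib (Y i) (Y 0) P P
  integrable : Integrable (Y 0) P
  mean : ∫ ω, Y 0 ω ∂P = 0
  integrable_rpow : Integrable (fun ω => |Y 0 ω| ^ q) P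
  moment_le : ∫ ω, |Y 0 ω| ^ q ∂P ≤ M

/-- A bound `exp f ≤ 1 + g` turns into a bound for the exponential moment, as `1 + c ≤ exp c`. -/
theorem lintegral_exp_le_of_le {P : Measure Ω} [IsProbabilityMeasure P] {f g : Ω → ℝ} {c : ℝ}
    (hg : Integrable g P) (h : ∀ ω, Real.exp (f ω) ≤ 1 + g ω) (hc : ∫ ω, g ω ∂P ≤ c) :
    ∫⁻ ω, ENNReal.ofReal (Real.exp (f ω)) ∂P ≤ ENNReal.ofReal (Real.exp c) := by
  have hi : Integrable (fun ω => 1 + g ω) P := (integrable_const 1).add hg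
  calc ∫⁻ ω, ENNReal.ofReal (Real.exp (f ω)) ∂P ≤ ∫⁻ ω, ENNReal.ofReal (1 + g ω) ∂P :=
        lintegral_mono fun ω => ENNReal.ofReal_le_ofReal (h ω)
    _ = ENNReal.ofReal (∫ ω, (1 + g ω) ∂P) := by
        rw [ofReal_integral_eq_lintegral_ofReal hi
          (Eventually.of_forall fun ω => (Real.exp_pos _).le.trans (h ω))]
    _ ≤ ENNReal.ofReal (Real.exp c) := by
        refine ENNReal.ofReal_le_ofReal ?_
        rw [integral_add (integrable_const 1) hg]
        simp only [integral_const, probReal_univ, smul_eq_mul, mul_one]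
        linarith [Real.add_one_le_exp c]

/-- The exponential Markov inequality. -/
theorem measure_le_exp_neg {P : Measure Ω} {f : Ω → ℝ} (hf : Measurable f) {a c : ℝ}
    (h : ∫⁻ ω, ENNReal.ofReal (Real.exp (f ω)) ∂P ≤ ENNReal.ofReal (Real.exp c)) :
    P {ω | a ≤ f ω} ≤ ENNReal.ofReal (Real.exp (c - a)) := by
  have h0 : ENNReal.ofReal (Real.exp a) ≠ 0 := by simp [Real.exp_pos]
  calc P {ω | a ≤ f ω}
      ≤ P {ω | ENNReal.ofReal (Real.exp a) ≤ ENNReal.ofReal (Real.exp (f ω))} :=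
        measure_mono fun ω hω => ENNReal.ofReal_le_ofReal (Real.exp_le_exp.2 hω)
    _ ≤ (∫⁻ ω, ENNReal.ofReal (Real.exp (f ω)) ∂P) / ENNReal.ofReal (Real.exp a) :=
        meas_ge_le_lintegral_div (by fun_prop) h0 ENNReal.ofReal_ne_top
    _ ≤ ENNReal.ofReal (Real.exp c) / ENNReal.ofReal (Real.exp a) := by gcongr
    _ = ENNReal.ofReal (Real.exp (c - a)) := by
        rw [← ENNReal.ofReal_div_of_pos (Real.exp_pos a), Real.exp_sub]

namespace IsCentredIID

variable {Y : ℕ → Ω → ℝ} {P : Measure Ω} {q M : ℝ}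

theorem integrable_comp (h : IsCentredIID Y P q M) {g : ℝ → ℝ} (hg : Measurable g)
    (hi : Integrable (fun ω => g (Y 0 ω)) P) (i : ℕ) : Integrable (fun ω => g (Y i ω)) P :=
  ((h.ident i).comp hg).integrable_iff.2 hi

theorem bound_nonneg (h : IsCentredIID Y P q M) : 0 ≤ M :=
  (integral_nonneg fun _ => Real.rpow_nonneg (abs_nonneg _) _).trans h.moment_le

theorem integrable_rpow_of_le (h : IsCentredIID Y P q M) {a : ℝ} (ha : 0 ≤ a) (haq : a ≤ q) :
    Integrable (fun ω => |Y 0 ω| ^ a) P := by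
  have := h.prob
  refine ((integrable_const (1 : ℝ)).add h.integrable_rpow).mono'
    (by have := h.meas 0; fun_prop) (Eventually.of_forall fun ω => ?_)
  rw [Real.norm_of_nonneg (Real.rpow_nonneg (abs_nonneg _) _)]
  exact rpow_le_one_add_rpow (abs_nonneg _) ha haq

theorem integral_rpow_le (h : IsCentredIID Y P q M) {a : ℝ} (ha : 0 ≤ a) (haq : a ≤ q) :
    ∫ ω, |Y 0 ω| ^ a ∂P ≤ 1 + M := by
  have := h.prob
  calc ∫ ω, |Y 0 ω| ^ a ∂P ≤ ∫ ω, (1 + |Y 0 ω| ^ q) ∂P :=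
        integral_mono (h.integrable_rpow_of_le ha haq)
          ((integrable_const (1 : ℝ)).add h.integrable_rpow)
          fun ω => rpow_le_one_add_rpow (abs_nonneg _) ha haq
    _ ≤ 1 + M := by
        rw [integral_add (integrable_const 1) h.integrable_rpow]
        simpa using h.moment_le

theorem integrable_sq (h : IsCentredIID Y P q M) (hq : 2 ≤ q) :
    Integrable (fun ω => Y 0 ω ^ 2) P := by
  simpa using h.integrable_rpow_of_le (a := 2) (by norm_num) hq

theorem integral_sq_le (h : IsCentredIID Y P q M) (hq : 2 ≤ q) :
    ∫ ω, Y 0 ω ^ 2 ∂P ≤ 1 + M := by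
  simpa using h.integral_rpow_le (a := 2) (by norm_num) hq

theorem lintegral_exp_sum_le (h : IsCentredIID Y P q M) {g : ℝ → ℝ} (hg : Measurable g) {c : ℝ}
    (hc : ∫⁻ ω, ENNReal.ofReal (Real.exp (g (Y 0 ω))) ∂P ≤ ENNReal.ofReal (Real.exp c)) (n : ℕ) :
    ∫⁻ ω, ENNReal.ofReal (Real.exp (∑ i ∈ Finset.range n, g (Y i ω))) ∂P
      ≤ ENNReal.ofReal (Real.exp (n * c)) := by
  have hm : Measurable fun y : ℝ => ENNReal.ofReal (Real.exp (g y)) := by fun_prop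
  calc ∫⁻ ω, ENNReal.ofReal (Real.exp (∑ i ∈ Finset.range n, g (Y i ω))) ∂P
      = ∫⁻ ω, ∏ i ∈ Finset.range n, ENNReal.ofReal (Real.exp (g (Y i ω))) ∂P := by
        refine lintegral_congr fun ω => ?_
        rw [Real.exp_sum, ENNReal.ofReal_prod_of_nonneg fun i _ => (Real.exp_pos _).le]
    _ = ∏ i ∈ Finset.range n, ∫⁻ ω, ENNReal.ofReal (Real.exp (g (Y i ω))) ∂P :=
        lintegral_prod_eq_prod_lintegral_of_indepFun _ _ (h.indep.comp _ fun _ => hm)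
          fun i => hm.comp (h.meas i)
    _ ≤ ∏ _i ∈ Finset.range n, ENNReal.ofReal (Real.exp c) := by
        refine Finset.prod_le_prod' fun i _ => ?_
        exact ((h.ident i).comp hm).lintegral_eq.trans_le hc
    _ = ENNReal.ofReal (Real.exp (n * c)) := by
        rw [Finset.prod_const, Finset.card_range, ← ENNReal.ofReal_pow (Real.exp_pos _).le,
          ← Real.exp_nat_mul]

/-- The self-normalised exponential `exp (l S - (l² / 2) (Q / 3 + 2 n V / 3))`, with `S` the sum,
`Q` the sum of squares and `V` the variance, has mean at most one. -/
theorem lintegral_selfNormalized_le_one (h : IsCentredIID Y P q M) (hq : 2 ≤ q) (l : ℝ) (n : ℕ) :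
    ∫⁻ ω, ENNReal.ofReal (Real.exp (l * ∑ i ∈ Finset.range n, Y i ω
      - l ^ 2 / 6 * ∑ i ∈ Finset.range n, Y i ω ^ 2
      - l ^ 2 / 3 * (n * ∫ ω, Y 0 ω ^ 2 ∂P))) ∂P ≤ 1 := by
  have := h.prob
  set V := ∫ ω, Y 0 ω ^ 2 ∂P with hV
  have h1 : ∫⁻ ω, ENNReal.ofReal (Real.exp (l * Y 0 ω - l ^ 2 / 6 * Y 0 ω ^ 2)) ∂P
      ≤ ENNReal.ofReal (Real.exp (l ^ 2 / 3 * V)) := by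
    refine lintegral_exp_le_of_le (g := fun ω => l * Y 0 ω + l ^ 2 / 3 * Y 0 ω ^ 2)
      ((h.integrable.const_mul l).add ((h.integrable_sq hq).const_mul _)) (fun ω => ?_) ?_
    · have := exp_sub_sq_div_six_le (l * Y 0 ω)
      rw [show l * Y 0 ω - l ^ 2 / 6 * Y 0 ω ^ 2 = l * Y 0 ω - (l * Y 0 ω) ^ 2 / 6 by ring]
      linarith
    · rw [integral_add (h.integrable.const_mul l) ((h.integrable_sq hq).const_mul _),
        integral_const_mul, integral_const_mul, h.mean, hV]
      simp
  have h2 := h.lintegral_exp_sum_le (g := fun y => l * y - l ^ 2 / 6 * y ^ 2) (by fun_prop) h1 n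
  have h3 : ∀ ω, ENNReal.ofReal (Real.exp (l * ∑ i ∈ Finset.range n, Y i ω
      - l ^ 2 / 6 * ∑ i ∈ Finset.range n, Y i ω ^ 2 - l ^ 2 / 3 * (n * V)))
      = ENNReal.ofReal (Real.exp (∑ i ∈ Finset.range n, (l * Y i ω - l ^ 2 / 6 * Y i ω ^ 2)))
        * ENNReal.ofReal (Real.exp (-(n * (l ^ 2 / 3 * V)))) := by
    intro ω
    rw [← ENNReal.ofReal_mul (Real.exp_pos _).le, ← Real.exp_add, Finset.sum_sub_distrib,
      ← Finset.mul_sum, ← Finset.mul_sum]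
    congr 2
    ring
  simp_rw [h3]
  have hm := h.meas
  rw [lintegral_mul_const _ (by fun_prop)]
  calc _ ≤ ENNReal.ofReal (Real.exp (n * (l ^ 2 / 3 * V)))
        * ENNReal.ofReal (Real.exp (-(n * (l ^ 2 / 3 * V)))) := by gcongr
    _ = 1 := by
        rw [← ENNReal.ofReal_mul (Real.exp_pos _).le, ← Real.exp_add]
        simp

theorem lintegral_mixture_le_one (h : IsCentredIID Y P q M) (hq : 2 ≤ q) (F : Measure ℝ)
    [IsProbabilityMeasure F] (n : ℕ) :
    ∫⁻ ω, ∫⁻ l, ENNReal.ofReal (Real.exp (l * ∑ i ∈ Finset.range n, Y i ω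
      - l ^ 2 / 6 * ∑ i ∈ Finset.range n, Y i ω ^ 2
      - l ^ 2 / 3 * (n * ∫ ω, Y 0 ω ^ 2 ∂P))) ∂F ∂P ≤ 1 := by
  have := h.prob
  have hm := h.meas
  rw [lintegral_lintegral_swap]
  · calc _ ≤ ∫⁻ _l, 1 ∂F := lintegral_mono fun l => h.lintegral_selfNormalized_le_one hq l n
      _ = 1 := by simp
  · simp only [Function.uncurry_def]
    fun_prop

/-! ### Deviation bounds -/

/-- Jensen's inequality bounds the power `q / 2` of the mean square by the mean of `|Y|^q`. -/
theorem measure_sum_sq_gt_le (h : IsCentredIID Y P q M) (hq : 2 ≤ q) {n : ℕ} (hn : 0 < n)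
    {t : ℝ} (ht : 0 < t) :
    P {ω | n * t < ∑ i ∈ Finset.range n, Y i ω ^ 2} ≤ ENNReal.ofReal (M / t ^ (q / 2)) := by
  have := h.prob
  have hm := h.meas
  have hn' : (0 : ℝ) < n := by exact_mod_cast hn
  have hI : ∀ i, Integrable (fun ω => |Y i ω| ^ q) P :=
    h.integrable_comp (g := fun y => |y| ^ q) (by fun_prop) h.integrable_rpow
  have hE : ∀ i, ∫ ω, |Y i ω| ^ q ∂P ≤ M := fun i => by
    have : ∫ ω, |Y i ω| ^ q ∂P = ∫ ω, |Y 0 ω| ^ q ∂P :=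
      ((h.ident i).comp (u := fun y : ℝ => |y| ^ q) (by fun_prop)).integral_eq
    exact this ▸ h.moment_le
  set Z : Ω → ℝ := fun ω => ∑ i ∈ Finset.range n, (n : ℝ)⁻¹ * |Y i ω| ^ q with hZ
  have hZi : Integrable Z P := integrable_finsetSum _ fun i _ => (hI i).const_mul _
  have hZ0 : ∀ ω, 0 ≤ Z ω := fun ω => Finset.sum_nonneg fun i _ => by positivity
  have hZE : ∫ ω, Z ω ∂P ≤ M := by
    rw [hZ, integral_finsetSum _ fun i _ => (hI i).const_mul _]
    calc _ ≤ ∑ _i ∈ Finset.range n, (n : ℝ)⁻¹ * M := by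
          refine Finset.sum_le_sum fun i _ => ?_
          rw [integral_const_mul]
          exact mul_le_mul_of_nonneg_left (hE i) (by positivity)
      _ = M := by
          rw [Finset.sum_const, Finset.card_range, nsmul_eq_mul]
          field_simp
  have hsub : {ω | n * t < ∑ i ∈ Finset.range n, Y i ω ^ 2}
      ⊆ {ω | ENNReal.ofReal (t ^ (q / 2)) ≤ ENNReal.ofReal (Z ω)} := by
    intro ω hω
    simp only [Set.mem_ofPred_eq] at hω ⊢
    refine ENNReal.ofReal_le_ofReal ?_
    have hJ := Real.rpow_arith_mean_le_arith_mean_rpow (Finset.range n) (fun _ => (n : ℝ)⁻¹)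
      (fun i => Y i ω ^ 2) (fun _ _ => by positivity)
      (by rw [Finset.sum_const, Finset.card_range, nsmul_eq_mul]; field_simp)
      (fun _ _ => sq_nonneg _) (p := q / 2) (by linarith)
    have hpow : ∀ i, (Y i ω ^ 2) ^ (q / 2) = |Y i ω| ^ q := fun i => by
      rw [← sq_abs, ← Real.rpow_two, ← Real.rpow_mul (abs_nonneg _)]
      congr 1
      ring
    simp only [hpow] at hJ
    refine le_trans (Real.rpow_le_rpow ht.le ?_ (by linarith)) hJ
    rw [← Finset.mul_sum, inv_mul_eq_div, le_div_iff₀ hn']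
    linarith
  have ht' : 0 < t ^ (q / 2) := Real.rpow_pos_of_pos ht _
  calc _ ≤ P {ω | ENNReal.ofReal (t ^ (q / 2)) ≤ ENNReal.ofReal (Z ω)} := measure_mono hsub
    _ ≤ (∫⁻ ω, ENNReal.ofReal (Z ω) ∂P) / ENNReal.ofReal (t ^ (q / 2)) :=
        meas_ge_le_lintegral_div (by fun_prop) (by simpa using ht') ENNReal.ofReal_ne_top
    _ = ENNReal.ofReal ((∫ ω, Z ω ∂P) / t ^ (q / 2)) := by
        rw [← ofReal_integral_eq_lintegral_ofReal hZi (Eventually.of_forall hZ0),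
          ENNReal.ofReal_div_of_pos ht']
    _ ≤ _ := by gcongr

theorem measure_selfNormalized_ge_le (h : IsCentredIID Y P q M) (hq : 2 ≤ q) (l a : ℝ) (n : ℕ) :
    P {ω | a ≤ l * ∑ i ∈ Finset.range n, Y i ω - l ^ 2 / 6 * ∑ i ∈ Finset.range n, Y i ω ^ 2
      - l ^ 2 / 3 * (n * ∫ ω, Y 0 ω ^ 2 ∂P)} ≤ ENNReal.ofReal (Real.exp (-a)) := by
  have hm := h.meas
  rw [← zero_sub]
  exact measure_le_exp_neg (by fun_prop)
    ((h.lintegral_selfNormalized_le_one hq l n).trans (by simp))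

/-- A Gaussian bound for the sum on the event that the sum of squares is at most `B`, obtained by
optimising the self-normalised exponential in `l`. -/
theorem measure_sum_sq_ge_inter_le (h : IsCentredIID Y P q M) (hq : 2 ≤ q) {n : ℕ}
    {x B : ℝ} (hx : 0 ≤ x) (hB : 0 < B) (hnB : n ≤ B) :
    P {ω | x < (∑ i ∈ Finset.range n, Y i ω) ^ 2 ∧ ∑ i ∈ Finset.range n, Y i ω ^ 2 ≤ B}
      ≤ ENNReal.ofReal (2 * Real.exp (-(x / (2 * ((1 + M) * B))))) := by
  have hM := h.bound_nonneg
  have hV := h.integral_sq_le hq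
  set V := ∫ ω, Y 0 ω ^ 2 ∂P
  set D := (1 + M) * B with hD
  have hD0 : 0 < D := by positivity
  -- The maximiser of `l * √x - l ^ 2 / 2 * D`, where `D` dominates `Q / 3 + 2 n V / 3`.
  set l := √x / D with hl
  have hl0 : 0 ≤ l := by positivity
  have hlx : l * √x - l ^ 2 / 2 * D = x / (2 * D) := by
    rw [hl]
    have := Real.sq_sqrt hx
    field_simp
    linarith
  have hnV : n * V ≤ D := by
    calc n * V ≤ B * (1 + M) := mul_le_mul hnB hV
          (integral_nonneg fun _ => sq_nonneg _) hB.le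
      _ = D := by rw [hD]; ring
  have hBD : B ≤ D := by nlinarith
  have key : ∀ s Q : ℝ, √x ≤ s → Q ≤ B →
      x / (2 * D) ≤ l * s - l ^ 2 / 6 * Q - l ^ 2 / 3 * (n * V) := by
    intro s Q hs hQ
    have h1 : l * √x ≤ l * s := mul_le_mul_of_nonneg_left hs hl0
    have h2 : l ^ 2 / 6 * Q ≤ l ^ 2 / 6 * D := by
      gcongr
      linarith
    have h3 : l ^ 2 / 3 * (n * V) ≤ l ^ 2 / 3 * D := by gcongr
    linarith
  calc _ ≤ P ({ω | x / (2 * D) ≤ l * ∑ i ∈ Finset.range n, Y i ω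
          - l ^ 2 / 6 * ∑ i ∈ Finset.range n, Y i ω ^ 2 - l ^ 2 / 3 * (n * V)}
        ∪ {ω | x / (2 * D) ≤ (-l) * ∑ i ∈ Finset.range n, Y i ω
          - (-l) ^ 2 / 6 * ∑ i ∈ Finset.range n, Y i ω ^ 2 - (-l) ^ 2 / 3 * (n * V)}) := by
        refine measure_mono fun ω hω => ?_
        obtain ⟨hω1, hω2⟩ := hω
        have : √x ≤ |∑ i ∈ Finset.range n, Y i ω| := by
          rw [← Real.sqrt_sq_eq_abs]
          exact Real.sqrt_le_sqrt hω1.le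
        rcases le_abs'.1 this with h1 | h1
        · right
          have := key (-∑ i ∈ Finset.range n, Y i ω) _ (by linarith) hω2
          simp only [Set.mem_ofPred_eq, neg_sq]
          linarith
        · left
          exact key _ _ h1 hω2
    _ ≤ ENNReal.ofReal (Real.exp (-(x / (2 * D)))) + ENNReal.ofReal (Real.exp (-(x / (2 * D)))) :=
        (measure_union_le _ _).trans (add_le_add (h.measure_selfNormalized_ge_le hq _ _ _)
          (h.measure_selfNormalized_ge_le hq _ _ _))
    _ = _ := by
        rw [← ENNReal.ofReal_add (Real.exp_pos _).le (Real.exp_pos _).le]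
        congr 1
        ring

/-- The lower tail of a sum of nonnegative variables is exponentially small under a moment
of order `p > 1` only, since `exp (-x) ≤ 1 - x + x ^ p` for `x ≥ 0`. -/
theorem measure_sum_sq_le_le (h : IsCentredIID Y P q M) {p : ℝ} (hp : 1 ≤ p) (hp2 : p ≤ 2)
    (hpq : 2 * p ≤ q) {s : ℝ} (hs : 0 ≤ s) (t : ℝ) (n : ℕ) :
    P {ω | ∑ i ∈ Finset.range n, Y i ω ^ 2 ≤ n * (∫ ω, Y 0 ω ^ 2 ∂P - t)}
      ≤ ENNReal.ofReal (Real.exp (-(n * (s * t - s ^ p * (1 + M))))) := by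
  have := h.prob
  have hm := h.meas
  have hq : 2 ≤ q := by linarith
  set V := ∫ ω, Y 0 ω ^ 2 ∂P with hV
  have hi1 := (h.integrable_sq hq).const_mul (-s)
  have hi2 := (h.integrable_rpow_of_le (a := 2 * p) (by linarith) hpq).const_mul (s ^ p)
  have h1 : ∫⁻ ω, ENNReal.ofReal (Real.exp (-s * Y 0 ω ^ 2)) ∂P
      ≤ ENNReal.ofReal (Real.exp (-s * V + s ^ p * (1 + M))) := by
    refine lintegral_exp_le_of_le (hi1.add hi2) (fun ω => ?_) ?_
    · have := exp_neg_le_one_sub_add_rpow (x := s * Y 0 ω ^ 2) (by positivity) hp hp2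
      rw [Real.mul_rpow hs (sq_nonneg _), ← sq_abs, ← Real.rpow_two,
        ← Real.rpow_mul (abs_nonneg _)] at this
      simp only [Pi.add_apply]
      rw [← sq_abs, ← Real.rpow_two, neg_mul]
      linarith
    · simp only [Pi.add_apply]
      rw [integral_add hi1 hi2, integral_const_mul, integral_const_mul]
      have := mul_le_mul_of_nonneg_left (h.integral_rpow_le (a := 2 * p) (by linarith) hpq)
        (Real.rpow_nonneg hs p)
      linarith
  have h2 := h.lintegral_exp_sum_le (g := fun y => -s * y ^ 2) (by fun_prop) h1 n
  have h3 := measure_le_exp_neg (a := -s * (n * (V - t))) (by fun_prop) h2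
  calc _ ≤ _ := measure_mono fun ω hω => ?_
    _ ≤ _ := h3
    _ = _ := ?_
  · simp only [Set.mem_ofPred_eq] at hω ⊢
    rw [← Finset.mul_sum, neg_mul, neg_mul, neg_le_neg_iff]
    exact mul_le_mul_of_nonneg_left hω hs
  · congr 2
    ring

end IsCentredIID
end IID

/-! ### The truncated mixture -/

/-- The sample variance in terms of deviations from an arbitrary centre. -/
theorem natCast_mul_sampleVar {Ω : Type*} (X : ℕ → Ω → ℝ) (θ : ℝ) {n : ℕ} (hn : 0 < n) (ω : Ω) :
    n * sampleVar X n ω = ∑ i ∈ Finset.range n, (X i ω - θ) ^ 2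
      - (∑ i ∈ Finset.range n, (X i ω - θ)) ^ 2 / n := by
  have hn' : (n : ℝ) ≠ 0 := by exact_mod_cast hn.ne'
  have hmean : sampleMean X n ω = θ + (∑ i ∈ Finset.range n, (X i ω - θ)) / n := by
    rw [sampleMean, Finset.sum_sub_distrib, Finset.sum_const, Finset.card_range, nsmul_eq_mul]
    field_simp
    ring
  set S := ∑ i ∈ Finset.range n, (X i ω - θ) with hS
  rw [sampleVar, mul_div_cancel₀ _ hn', hmean]
  calc _ = ∑ i ∈ Finset.range n, ((X i ω - θ) ^ 2 - 2 * (S / n) * (X i ω - θ) + (S / n) ^ 2) :=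
        Finset.sum_congr rfl fun i _ => by ring
    _ = _ := by
        rw [Finset.sum_add_distrib, Finset.sum_sub_distrib, ← Finset.mul_sum, ← hS,
          Finset.sum_const, Finset.card_range, nsmul_eq_mul]
        field_simp
        ring

section Mixture

variable {Ω : Type*} [MeasurableSpace Ω]

theorem measurable_rwsEVariable {X : ℕ → Ω → ℝ} (hX : ∀ n, Measurable (X n)) (θ : ℝ)
    (F : Measure ℝ) [IsProbabilityMeasure F] (ε T : ℕ → ℝ) (n : ℕ) :
    Measurable (rwsEVariable X θ F ε T n) := by
  have h1 : Measurable (centredSum X θ n) := by unfold centredSum; fun_prop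
  have h2 : Measurable (sampleMean X n) := by unfold sampleMean; fun_prop
  have h3 : Measurable (sampleVar X n) := by unfold sampleVar; fun_prop
  refine Measurable.min ?_ measurable_const
  exact Measurable.lintegral_prod_right' (f := fun z : Ω × ℝ => ENNReal.ofReal
    (Real.exp (z.2 * centredSum X θ n z.1 - n * (sampleVar X n z.1 + ε n) * (z.2 ^ 2 / 2))))
    (by fun_prop)

/-- Bound for the probability that the regularised sample variance `ŝ² + ε` falls below the weighted
mean `Q / (3 n) + 2 V / 3` of empirical and true second moments, when `M` bounds the moment of order
`2 + δ`. The terms bound, in this order, the upper tail of `Q` (level `n ^ (1 + γ)`), the deviation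
of the sum below that level, and the lower tail of `Q` (exponential Markov inequality with parameter
`n ^ (-1 / 2)`). -/
noncomputable def deviationBound (γ δ M : ℝ) (ε : ℕ → ℝ) (n : ℕ) : ℝ :=
  M / ((n : ℝ) ^ γ) ^ ((2 + δ) / 2)
    + 2 * Real.exp (-(n ^ 2 * ε n / 2 / (2 * ((1 + M) * (n * (n : ℝ) ^ γ)))))
    + Real.exp (-(n * ((n : ℝ) ^ (-(1 / 2) : ℝ) * (3 / 4 * ε n)
      - ((n : ℝ) ^ (-(1 / 2) : ℝ)) ^ min (1 + δ / 2) 2 * (1 + M))))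

/-- On the exceptional event `A ∪ B ∪ C` the truncation is used, elsewhere the comparison with the
self-normalised mixture. -/
theorem lintegral_rwsEVariable_le {X : ℕ → Ω → ℝ} {θ γ δ M : ℝ} {P : Measure Ω}
    (h : IsCentredIID (fun i ω => X i ω - θ) P (2 + δ) M) (hγ : 0 ≤ γ) (hδ : 0 ≤ δ)
    (F : Measure ℝ) [IsProbabilityMeasure F] {ε T : ℕ → ℝ} {n : ℕ} (hn : 0 < n)
    (hεn : 0 ≤ ε n) (hTn : 0 ≤ T n) :
    ∫⁻ ω, rwsEVariable X θ F ε T n ω ∂P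
      ≤ 1 + ENNReal.ofReal (T n * deviationBound γ δ M ε n) := by
  have := h.prob
  have hm := h.meas
  have hM := h.bound_nonneg
  have hn' : (0 : ℝ) < n := by exact_mod_cast hn
  have hn1 : (1 : ℝ) ≤ n := by exact_mod_cast hn
  have hq : 2 ≤ 2 + δ := by linarith
  have hnγ : 0 < (n : ℝ) ^ γ := Real.rpow_pos_of_pos hn' _
  have hnγ1 : 1 ≤ (n : ℝ) ^ γ := Real.one_le_rpow hn1 hγ
  set V := ∫ ω, (X 0 ω - θ) ^ 2 ∂P with hV
  set S : Ω → ℝ := fun ω => ∑ i ∈ Finset.range n, (X i ω - θ) with hS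
  set Q : Ω → ℝ := fun ω => ∑ i ∈ Finset.range n, (X i ω - θ) ^ 2 with hQ
  set A : Set Ω := {ω | n * (n : ℝ) ^ γ < Q ω} with hA
  set B : Set Ω := {ω | n ^ 2 * ε n / 2 < S ω ^ 2 ∧ Q ω ≤ n * (n : ℝ) ^ γ} with hB
  set C : Set Ω := {ω | Q ω ≤ n * (V - 3 / 4 * ε n)} with hC
  have hPA : P A ≤ _ := h.measure_sum_sq_gt_le hq hn hnγ
  have hPB : P B ≤ _ := h.measure_sum_sq_ge_inter_le hq (n := n) (x := n ^ 2 * ε n / 2)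
    (B := n * (n : ℝ) ^ γ) (by positivity) (by positivity) (by nlinarith)
  have hPC : P C ≤ _ := h.measure_sum_sq_le_le (p := min (1 + δ / 2) 2)
    (le_min (by linarith) (by norm_num)) (min_le_right _ _)
    (by linarith [min_le_left (1 + δ / 2) 2]) (s := (n : ℝ) ^ (-(1 / 2) : ℝ)) (by positivity)
    (3 / 4 * ε n) n
  have hSm : Measurable S := by fun_prop
  have hQm : Measurable Q := by fun_prop
  have hABC : MeasurableSet (A ∪ B ∪ C) :=
    ((measurableSet_lt measurable_const hQm).union
      ((measurableSet_lt measurable_const (hSm.pow_const 2)).inter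
        (measurableSet_le hQm measurable_const))).union (measurableSet_le hQm measurable_const)
  set G : Ω → ℝ≥0∞ := fun ω => ∫⁻ l, ENNReal.ofReal (Real.exp (l * S ω
      - l ^ 2 / 6 * Q ω - l ^ 2 / 3 * (n * V))) ∂F with hG
  have hGE : ∫⁻ ω, G ω ∂P ≤ 1 := h.lintegral_mixture_le_one hq F n
  have hpt : ∀ ω, rwsEVariable X θ F ε T n ω
      ≤ G ω + (A ∪ B ∪ C).indicator (fun _ => ENNReal.ofReal (T n)) ω := by
    intro ω
    by_cases hω : ω ∈ A ∪ B ∪ C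
    · rw [Set.indicator_of_mem hω]
      exact (min_le_right _ _).trans le_add_self
    · rw [Set.indicator_of_notMem hω, add_zero]
      refine (min_le_left _ _).trans (lintegral_mono fun l => ENNReal.ofReal_le_ofReal
        (Real.exp_le_exp.2 ?_))
      simp only [hA, hB, hC, Set.mem_union, Set.mem_ofPred_eq, not_or, not_and, not_lt,
        not_le] at hω
      obtain ⟨⟨h1, h2⟩, h3⟩ := hω
      have hS2 : S ω ^ 2 / n ≤ n * ε n / 2 := by
        rw [div_le_iff₀ hn']
        have : S ω ^ 2 ≤ n ^ 2 * ε n / 2 := by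
          by_contra hcon
          exact absurd h1 (not_le.2 (h2 (not_le.1 hcon)))
        linarith
      have hvar := natCast_mul_sampleVar X θ hn ω
      change _ = Q ω - S ω ^ 2 / n at hvar
      change l * S ω - n * (sampleVar X n ω + ε n) * (l ^ 2 / 2) ≤ _
      -- `n (ŝ² + ε) - Q / 3 - 2 n V / 3 = (2 / 3) (Q - n V) + n ε - S² / n`, with the first term at
      -- least `-n ε / 2` and the last at least `-n ε / 2`.
      have hkey : 0 ≤ l ^ 2 / 2 * (n * (sampleVar X n ω + ε n) - Q ω / 3 - 2 / 3 * (n * V)) := by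
        refine mul_nonneg (by positivity) ?_
        linarith
      linarith
  have hind : P (A ∪ B ∪ C) ≤ ENNReal.ofReal (deviationBound γ δ M ε n) := by
    calc P (A ∪ B ∪ C) ≤ P A + P B + P C :=
          (measure_union_le _ _).trans (by gcongr; exact measure_union_le _ _)
      _ ≤ _ := add_le_add (add_le_add hPA hPB) hPC
      _ = _ := by
          rw [← ENNReal.ofReal_add (by positivity) (by positivity),
            ← ENNReal.ofReal_add (by positivity) (by positivity)]
          rfl
  calc ∫⁻ ω, rwsEVariable X θ F ε T n ω ∂P
      ≤ ∫⁻ ω, (G ω + (A ∪ B ∪ C).indicator (fun _ => ENNReal.ofReal (T n)) ω) ∂P :=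
        lintegral_mono hpt
    _ = ∫⁻ ω, G ω ∂P + ENNReal.ofReal (T n) * P (A ∪ B ∪ C) := by
        rw [lintegral_add_right _ (measurable_const.indicator hABC),
          lintegral_indicator_const hABC]
    _ ≤ 1 + ENNReal.ofReal (T n) * ENNReal.ofReal (deviationBound γ δ M ε n) := by gcongr
    _ = _ := by rw [ENNReal.ofReal_mul hTn]

end Mixture

/-! ### Asymptotics of the error term -/

theorem tendsto_natCast_rpow_mul_exp_neg (a : ℝ) {b c : ℝ} (hb : 0 < b) (hc : 0 < c) :
    Tendsto (fun n : ℕ => (n : ℝ) ^ a * Real.exp (-(c * (n : ℝ) ^ b))) atTop (𝓝 0) := by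
  have h := (tendsto_rpow_mul_exp_neg_mul_atTop_nhds_zero (a / b) c hc).comp
    ((tendsto_rpow_atTop hb).comp tendsto_natCast_atTop_atTop)
  refine h.congr fun n => ?_
  simp only [Function.comp_apply]
  rw [← Real.rpow_mul n.cast_nonneg, mul_div_cancel₀ _ hb.ne', neg_mul]

theorem tendsto_natCast_rpow_neg {a : ℝ} (ha : 0 < a) :
    Tendsto (fun n : ℕ => (n : ℝ) ^ (-a)) atTop (𝓝 0) :=
  (tendsto_rpow_neg_atTop ha).comp tendsto_natCast_atTop_atTop

/-- Since `T n → ∞`, the growth condition on `T` also keeps `ε` from vanishing too fast: otherwise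
`n ^ (δ γ / 2) * ε ^ (2 + δ / 2) < 1`. -/
theorem eventually_rpow_neg_le {δ γ : ℝ} (hδ : 0 < δ) {T ε : ℕ → ℝ} (hε : ∀ n, 0 ≤ ε n)
    (hT_lim : Tendsto T atTop atTop)
    (hTε : T =o[atTop] fun n : ℕ => (n : ℝ) ^ (δ * γ / 2) * ε n ^ (2 + δ / 2)) :
    ∀ᶠ n : ℕ in atTop, (n : ℝ) ^ (-(δ * γ / (4 + δ))) ≤ ε n := by
  filter_upwards [hTε.bound one_pos, hT_lim.eventually_ge_atTop 1, eventually_gt_atTop 0]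
    with n h1 h2 hn
  have hn' : (0 : ℝ) < n := by exact_mod_cast hn
  have hεn := hε n
  rw [one_mul, Real.norm_of_nonneg (by linarith), Real.norm_of_nonneg (by positivity)] at h1
  by_contra! hcon
  have h3 : ε n ^ (2 + δ / 2) < (n : ℝ) ^ (-(δ * γ / 2)) := by
    have := Real.rpow_lt_rpow hεn hcon (z := 2 + δ / 2) (by positivity)
    rw [← Real.rpow_mul hn'.le] at this
    convert this using 2
    field_simp
    ring
  have h4 : (n : ℝ) ^ (δ * γ / 2) * ε n ^ (2 + δ / 2)
      < (n : ℝ) ^ (δ * γ / 2) * (n : ℝ) ^ (-(δ * γ / 2)) :=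
    mul_lt_mul_of_pos_left h3 (Real.rpow_pos_of_pos hn' _)
  rw [← Real.rpow_add hn', add_neg_cancel, Real.rpow_zero] at h4
  linarith

theorem eventually_le_rpow {δ γ : ℝ} (hδ : 0 < δ) {T ε : ℕ → ℝ} (hT : ∀ n, 0 ≤ T n)
    (hε : ∀ n, 0 ≤ ε n) (hε_lim : Tendsto ε atTop (𝓝 0))
    (hTε : T =o[atTop] fun n : ℕ => (n : ℝ) ^ (δ * γ / 2) * ε n ^ (2 + δ / 2)) :
    ∀ᶠ n : ℕ in atTop, T n ≤ (n : ℝ) ^ (δ * γ / 2) := by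
  filter_upwards [hTε.bound one_pos, hε_lim.eventually_le_const one_pos] with n h1 h2
  have hεn := hε n
  rw [one_mul, Real.norm_of_nonneg (hT n), Real.norm_of_nonneg (by positivity)] at h1
  exact h1.trans (mul_le_of_le_one_right (by positivity)
    (Real.rpow_le_one hεn h2 (by positivity)))

theorem tendsto_mul_deviationBound {δ γ M : ℝ} (hγ : 0 < γ) (hγ' : γ < 1 / 2) (hδ : 0 < δ)
    (hM : 0 ≤ M) {T ε : ℕ → ℝ} (hT : ∀ n, 0 ≤ T n) (hε : ∀ n, 0 ≤ ε n)
    (hT_lim : Tendsto T atTop atTop) (hε_lim : Tendsto ε atTop (𝓝 0))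
    (hTε : T =o[atTop] fun n : ℕ => (n : ℝ) ^ (δ * γ / 2) * ε n ^ (2 + δ / 2)) :
    Tendsto (fun n => T n * deviationBound γ δ M ε n) atTop (𝓝 0) := by
  set κ := δ * γ / (4 + δ) with hκ
  have hε_ge := eventually_rpow_neg_le hδ hε hT_lim hTε
  have hT_le := eventually_le_rpow hδ hT hε hε_lim hTε
  have hκγ : κ < γ := by
    rw [hκ, div_lt_iff₀ (by positivity)]
    nlinarith
  have hκδ : κ < δ / 4 := by
    rw [hκ, div_lt_iff₀ (by positivity)]
    nlinarith
  set p := min (1 + δ / 2) 2 with hp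
  -- The lower-tail parameter `n ^ (-1 / 2)` works for every `δ`: `κ < (p - 1) / 2` makes the moment
  -- term negligible against `ε`, and `κ < 1 / 2` makes the exponent `n ^ (1 / 2 - κ)` diverge.
  have hκp : κ < (p - 1) / 2 := by
    rcases min_choice (1 + δ / 2) 2 with h | h <;> rw [hp, h] <;> linarith
  have hK : (0 : ℝ) < 1 + M := by positivity
  have l1 : Tendsto (fun n : ℕ => M * (n : ℝ) ^ (-γ)) atTop (𝓝 0) := by
    simpa using (tendsto_natCast_rpow_neg hγ).const_mul M
  have l2 := (tendsto_natCast_rpow_mul_exp_neg (δ * γ / 2) (b := 1 - γ - κ)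
    (c := 1 / (4 * (1 + M))) (by linarith) (by positivity)).const_mul 2
  have l3 := tendsto_natCast_rpow_mul_exp_neg (δ * γ / 2) (b := 1 / 2 - κ) (c := 1 / 2)
    (by linarith) (by norm_num)
  have hsmall : ∀ᶠ n : ℕ in atTop, (1 + M) * (n : ℝ) ^ (-((p - 1) / 2 - κ)) ≤ 1 / 4 := by
    have := (tendsto_natCast_rpow_neg (a := (p - 1) / 2 - κ) (by linarith)).const_mul (1 + M)
    rw [mul_zero] at this
    exact this.eventually_le_const (by norm_num)
  have hsum := (l1.add l2).add l3
  rw [mul_zero, add_zero, add_zero] at hsum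
  refine tendsto_of_tendsto_of_tendsto_of_le_of_le' tendsto_const_nhds hsum ?_ ?_
  · refine Eventually.of_forall fun n => mul_nonneg (hT n) ?_
    unfold deviationBound
    positivity
  filter_upwards [hε_ge, hT_le, hsmall, eventually_gt_atTop 0] with n h1 h2 h3 hn
  have hn' : (0 : ℝ) < n := by exact_mod_cast hn
  have e1 : T n * (M / ((n : ℝ) ^ γ) ^ ((2 + δ) / 2)) ≤ M * (n : ℝ) ^ (-γ) := by
    calc _ ≤ (n : ℝ) ^ (δ * γ / 2) * (M / ((n : ℝ) ^ γ) ^ ((2 + δ) / 2)) := by gcongr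
      _ = M * ((n : ℝ) ^ (δ * γ / 2) * (n : ℝ) ^ (-(γ * ((2 + δ) / 2)))) := by
          rw [← Real.rpow_mul hn'.le, Real.rpow_neg hn'.le]
          ring
      _ = _ := by
          rw [← Real.rpow_add hn']
          congr 2
          ring
  have e2 : T n * (2 * Real.exp (-(n ^ 2 * ε n / 2 / (2 * ((1 + M) * (n * (n : ℝ) ^ γ))))))
      ≤ 2 * ((n : ℝ) ^ (δ * γ / 2)
        * Real.exp (-(1 / (4 * (1 + M)) * (n : ℝ) ^ (1 - γ - κ)))) := by
    rw [mul_left_comm]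
    gcongr
    calc 1 / (4 * (1 + M)) * (n : ℝ) ^ (1 - γ - κ)
        = n ^ 2 * (n : ℝ) ^ (-κ) / 2 / (2 * ((1 + M) * (n * (n : ℝ) ^ γ))) := by
          rw [sub_eq_add_neg, Real.rpow_add hn', Real.rpow_sub hn', Real.rpow_one]
          field_simp
          ring
      _ ≤ _ := by gcongr
  have e3 : T n * Real.exp (-(n * ((n : ℝ) ^ (-(1 / 2) : ℝ) * (3 / 4 * ε n)
      - ((n : ℝ) ^ (-(1 / 2) : ℝ)) ^ p * (1 + M))))
      ≤ (n : ℝ) ^ (δ * γ / 2) * Real.exp (-(1 / 2 * (n : ℝ) ^ (1 / 2 - κ))) := by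
    refine mul_le_mul h2 (Real.exp_le_exp.2 (neg_le_neg ?_)) (Real.exp_pos _).le (by positivity)
    have r1 : (n : ℝ) * ((n : ℝ) ^ (-(1 / 2) : ℝ) * (n : ℝ) ^ (-κ)) = (n : ℝ) ^ (1 / 2 - κ) := by
      rw [← Real.rpow_add hn', ← Real.rpow_one_add' hn'.le (by linarith)]
      congr 1
      ring
    have r2 : (n : ℝ) * ((n : ℝ) ^ (-(1 / 2) : ℝ)) ^ p
        = (n : ℝ) ^ (1 / 2 - κ) * (n : ℝ) ^ (-((p - 1) / 2 - κ)) := by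
      rw [← Real.rpow_mul hn'.le, ← Real.rpow_add hn', mul_comm, ← Real.rpow_add_one hn'.ne']
      congr 1
      ring
    have r3 : (n : ℝ) * ((n : ℝ) ^ (-(1 / 2) : ℝ) * (n : ℝ) ^ (-κ))
        ≤ n * ((n : ℝ) ^ (-(1 / 2) : ℝ) * ε n) := by gcongr
    have r4 := mul_le_mul_of_nonneg_left h3 (Real.rpow_nonneg hn'.le (1 / 2 - κ))
    have r5 : (n : ℝ) * (((n : ℝ) ^ (-(1 / 2) : ℝ)) ^ p * (1 + M))
        = (n : ℝ) ^ (1 / 2 - κ) * ((1 + M) * (n : ℝ) ^ (-((p - 1) / 2 - κ))) := by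
      rw [← mul_assoc, r2]
      ring
    rw [mul_sub, r5]
    rw [r1] at r3
    linarith
  unfold deviationBound
  rw [mul_add, mul_add]
  exact add_le_add (add_le_add e1 e2) e3

/-! ### Laws with uniformly bounded moments -/

section Laws

variable {Ω : Type*} [MeasurableSpace Ω]

theorem isCentredIID_of_mem_iidLaws {X : ℕ → Ω → ℝ} (hX : ∀ n, Measurable (X n)) {q θ M : ℝ}
    {P : Measure Ω} (hP : P ∈ iidLaws X q θ) (hM : ∫ ω, |X 0 ω - θ| ^ q ∂P ≤ M) :
    IsCentredIID (fun i ω => X i ω - θ) P q M := by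
  obtain ⟨hprob, hind, hid, -, hint, hmean, hmom⟩ := hP
  have hX0 := (hX 0).aemeasurable (μ := P)
  have hint' : Integrable (X 0) P := by
    rw [integrable_map_measure (by fun_prop) hX0] at hint
    exact hint
  refine ⟨hprob, fun i => by fun_prop, hind.comp (fun _ x => x - θ) fun _ => by fun_prop,
    fun i => (hid i).comp (u := fun x : ℝ => x - θ) (by fun_prop), hint'.sub (integrable_const θ),
    ?_, ?_, hM⟩
  · rw [integral_map hX0 (by fun_prop)] at hmean
    rw [integral_sub hint' (integrable_const θ), hmean]
    simp
  · have hmeas : Measurable fun x : ℝ => |x - θ| ^ q := by fun_prop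
    rw [integrable_map_measure hmeas.aestronglyMeasurable hX0] at hmom
    exact hmom

theorem abs_sub_rpow_le (x θ : ℝ) {q : ℝ} (hq : 0 ≤ q) :
    |x - θ| ^ q ≤ 2 ^ q * (|x| ^ q + |θ| ^ q) := by
  have h1 : |x - θ| ≤ 2 * max |x| |θ| := by
    linarith [abs_sub x θ, le_max_left |x| |θ|, le_max_right |x| |θ|]
  calc |x - θ| ^ q ≤ (2 * max |x| |θ|) ^ q := Real.rpow_le_rpow (abs_nonneg _) h1 hq
    _ = 2 ^ q * max |x| |θ| ^ q := Real.mul_rpow (by norm_num) (by positivity)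
    _ ≤ _ := by
        gcongr
        rcases max_choice |x| |θ| with h | h <;> rw [h]
        · exact le_add_of_nonneg_right (by positivity)
        · exact le_add_of_nonneg_left (by positivity)

theorem HasUniformlyBoundedMoment.exists_integral_le {𝒬 : Set (Measure Ω)} {Y : Ω → ℝ} {q : ℝ}
    (h : HasUniformlyBoundedMoment 𝒬 Y q) (hY : Measurable Y) (hq : 0 ≤ q)
    (h𝒬 : ∀ P ∈ 𝒬, IsProbabilityMeasure P) (θ : ℝ) :
    ∃ M : ℝ, 0 ≤ M ∧ ∀ P ∈ 𝒬, ∫ ω, |Y ω - θ| ^ q ∂P ≤ M := by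
  set K := ⨆ P ∈ 𝒬, ∫⁻ ω, ENNReal.ofReal (|Y ω| ^ q) ∂P with hK
  have hbound : ENNReal.ofReal (2 ^ q) * (K + ENNReal.ofReal (|θ| ^ q)) ≠ ∞ :=
    ENNReal.mul_ne_top ENNReal.ofReal_ne_top
      (ENNReal.add_ne_top.2 ⟨h.ne, ENNReal.ofReal_ne_top⟩)
  refine ⟨_, ENNReal.toReal_nonneg
    (a := ENNReal.ofReal (2 ^ q) * (K + ENNReal.ofReal (|θ| ^ q))), fun P hP => ?_⟩
  have := h𝒬 P hP
  rw [integral_eq_lintegral_of_nonneg_ae (Eventually.of_forall fun ω => by positivity)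
    (by fun_prop)]
  refine ENNReal.toReal_mono hbound ?_
  calc ∫⁻ ω, ENNReal.ofReal (|Y ω - θ| ^ q) ∂P
      ≤ ∫⁻ ω, ENNReal.ofReal (2 ^ q)
          * (ENNReal.ofReal (|Y ω| ^ q) + ENNReal.ofReal (|θ| ^ q)) ∂P := by
        refine lintegral_mono fun ω => ?_
        rw [← ENNReal.ofReal_add (by positivity) (by positivity),
          ← ENNReal.ofReal_mul (by positivity)]
        exact ENNReal.ofReal_le_ofReal (abs_sub_rpow_le _ _ hq)
    _ = ENNReal.ofReal (2 ^ q)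
          * (∫⁻ ω, ENNReal.ofReal (|Y ω| ^ q) ∂P + ENNReal.ofReal (|θ| ^ q)) := by
        rw [lintegral_const_mul _ (by fun_prop), lintegral_add_right _ measurable_const]
        simp
    _ ≤ _ := by
        gcongr
        exact le_iSup₂ (f := fun P (_ : P ∈ 𝒬) => ∫⁻ ω, ENNReal.ofReal (|Y ω| ^ q) ∂P) P hP

theorem limsup_iSup_lintegral_le_one {𝒬 : Set (Measure Ω)} {E : ℕ → Ω → ℝ≥0∞} {r : ℕ → ℝ}
    (hr : Tendsto r atTop (𝓝 0))
    (h : ∀ n, 0 < n → ∀ P ∈ 𝒬, ∫⁻ ω, E n ω ∂P ≤ 1 + ENNReal.ofReal (r n)) :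
    limsup (fun n => ⨆ P ∈ 𝒬, ∫⁻ ω, E n ω ∂P) atTop ≤ 1 := by
  have hlim : Tendsto (fun n => 1 + ENNReal.ofReal (r n)) atTop (𝓝 1) := by
    simpa using (ENNReal.tendsto_ofReal hr).const_add 1
  rw [← hlim.limsup_eq]
  refine limsup_le_limsup ?_
  filter_upwards [eventually_gt_atTop 0] with n hn using iSup₂_le (h n hn)

end Laws

theorem theorem4 {Ω : Type*} [MeasurableSpace Ω]
    (X : ℕ → Ω → ℝ) (hX : ∀ n, Measurable (X n))
    (θ γ δ : ℝ) (hγ : 0 < γ) (hγ' : γ < 1 / 2) (hδ : 0 < δ)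
    (T ε : ℕ → ℝ) (hT : ∀ n, 0 ≤ T n) (hε : ∀ n, 0 ≤ ε n)
    (hT_lim : Tendsto T atTop atTop) (hε_lim : Tendsto ε atTop (𝓝 0))
    (hTε : T =o[atTop] fun n : ℕ => (n : ℝ) ^ (δ * γ / 2) * ε n ^ (2 + δ / 2))
    (F : Measure ℝ) [IsProbabilityMeasure F] :
    IsAsymptoticEVariable (iidLaws X (2 + δ) θ) (rwsEVariable X θ F ε T) ∧
    ∀ 𝒬 ⊆ iidLaws X (2 + δ) θ,
      (∀ n, HasUniformlyBoundedMoment 𝒬 (X n) (2 + δ)) →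
      IsUniformAsymptoticEVariable 𝒬 (rwsEVariable X θ F ε T) := by
  have hmeas := measurable_rwsEVariable hX θ F ε T
  have huniform : ∀ 𝒬 ⊆ iidLaws X (2 + δ) θ, ∀ M, 0 ≤ M →
      (∀ P ∈ 𝒬, ∫ ω, |X 0 ω - θ| ^ (2 + δ) ∂P ≤ M) →
      limsup (fun n => ⨆ P ∈ 𝒬, ∫⁻ ω, rwsEVariable X θ F ε T n ω ∂P) atTop ≤ 1 :=
    fun 𝒬 h𝒬 M hM hb => limsup_iSup_lintegral_le_one
      (tendsto_mul_deviationBound hγ hγ' hδ hM hT hε hT_lim hε_lim hTε)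
      fun n hn P hP => lintegral_rwsEVariable_le (isCentredIID_of_mem_iidLaws hX (h𝒬 hP) (hb P hP))
        hγ.le hδ.le F hn (hε n) (hT n)
  refine ⟨⟨hmeas, iSup₂_le fun P hP => ?_⟩, fun 𝒬 h𝒬 hmom => ⟨hmeas, ?_⟩⟩
  · simpa using huniform {P} (by simpa using hP) (∫ ω, |X 0 ω - θ| ^ (2 + δ) ∂P)
      (integral_nonneg fun _ => Real.rpow_nonneg (abs_nonneg _) _) (by simp)
  · obtain ⟨M, hM, hb⟩ := (hmom 0).exists_integral_le (hX 0) (by positivity)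
      (fun P hP => (h𝒬 hP).1) θ
    exact huniform 𝒬 h𝒬 M hM hb
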